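/- Let $X$ be a Tychonoff space. Suppose that $X$ is airy, i.e. there is a countable family $\mathcal P$ of infinite subsets of $X$ such that $G_1\cap G_2\neq\emptyset$ for any two $G_\delta$-sets $G_1,G_2\subseteq X$ that are $\mathcal P$-dense, where $G\subseteq X$ is called $\mathcal P$-dense if $G\cap P\neq\emptyset$ for every $P\in\mathcal P$. Let $C_p(X)$ be the set of all continuous functions $X\to\mathbb R$ with the topology of pointwise convergence. Then $C_p(X)$ has the Banakh property: there is a sequence $(A_n)_{n\in\mathbb N}$ of closed nowhere dense subsets of $C_p(X)$ such that every compact subset of $C_p(X)$ is contained in $A_n$ for some $n\in\mathbb N$. -/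

import Mathlib

/-- A subset `G` of `X` is dense with respect to a family `P` of subsets of `X` if it meets every
member of `P`. -/
def FamilyDense {X : Type*} (P : Set (Set X)) (G : Set X) : Prop :=
  ∀ S ∈ P, (G ∩ S).Nonempty

/-- A topological space `X` is airy if it admits a countable family `P` of infinite subsets such
that any two `P`-dense `Gδ`-sets have nonempty intersection. -/
def IsAiry (X : Type*) [TopologicalSpace X] : Prop :=
  ∃ P : Set (Set X), P.Countable ∧ (∀ S ∈ P, S.Infinite) ∧
    ∀ G₁ G₂ : Set X, IsGδ G₁ → IsGδ G₂ → FamilyDense P G₁ → FamilyDense P G₂ →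
      (G₁ ∩ G₂).Nonempty

/-- The Banakh property: there is a countable family of closed nowhere dense sets such that every
compact set is contained in a member of the family. -/
def BanakhProperty (Y : Type*) [TopologicalSpace Y] : Prop :=
  ∃ A : ℕ → Set Y, (∀ n, IsClosed (A n) ∧ IsNowhereDense (A n)) ∧
    ∀ K : Set Y, IsCompact K → ∃ n, K ⊆ A n

/-- The space `C_p(X)` of continuous real-valued functions on `X`. Its topology is the subspace
topology inherited from the product space `X → ℝ`, that is, the topology of pointwise
convergence. -/
abbrev Cp (X : Type*) [TopologicalSpace X] : Type _ :=
  {f : X → ℝ // Continuous f}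

open Set Topology

/-! The witnesses are the sets of functions bounded by `n` on a member of the countable family. They
are nowhere dense because a basic neighborhood constrains only finitely many points. A compact `K`
is pointwise bounded; if it lies in none of them, fast-growing thresholds give a point-finite
sequence of open sets `{N i < |f|}`, `f ∈ K`, whose chosen points visit each member twice.
Point-finiteness puts the two visiting sequences into disjoint `Gδ`-sets, against airiness. -/

/-- If the members of a point-finite sequence of sets contain decreasing sequences of open sets,
then the union of the intersections of these sequences is a `Gδ`-set. -/
theorem isGδ_iUnion_iInter_of_pointFinite {X : Type*} [TopologicalSpace X] {V : ℕ → Set X}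
    {W : ℕ → ℕ → Set X} (hV : ∀ y, {k | y ∈ V k}.Finite) (hW : ∀ k m, IsOpen (W k m))
    (hWV : ∀ k m, W k m ⊆ V k) (hanti : ∀ k, Antitone (W k)) :
    IsGδ (⋃ k, ⋂ m, W k m) := by
  have heq : (⋃ k, ⋂ m, W k m) = ⋂ m, ⋃ k, W k m := by
    refine (iUnion_iInter_subset).antisymm fun y hy => ?_
    simp only [mem_iInter, mem_iUnion] at hy ⊢
    choose k hk using hy
    have hmaps : MapsTo k univ {k | y ∈ V k} := fun m _ => hWV _ _ (hk m)
    -- Pigeonhole: one index serves infinitely many `m`, hence all `m` by antitonicity.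
    obtain ⟨l, -, hl⟩ : ∃ l ∈ {k | y ∈ V k}, (univ ∩ k ⁻¹' {l}).Infinite := by
      by_contra! h
      refine infinite_univ (α := ℕ) (((hV y).biUnion fun l hl => h l hl).subset ?_)
      intro m _
      exact mem_biUnion (hmaps (mem_univ m)) ⟨mem_univ m, rfl⟩
    refine ⟨l, fun m => ?_⟩
    obtain ⟨n, hn, hmn⟩ := hl.exists_gt m
    have hkn : k n = l := hn.2
    exact hanti l hmn.le (hkn ▸ hk n)
  rw [heq]
  exact .iInter_of_isOpen fun m => isOpen_iUnion fun k => hW k m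

/-- Two disjoint sequences in a Hausdorff space having point-finite sequences of open
neighborhoods are contained in disjoint `Gδ`-sets. -/
theorem exists_disjoint_isGδ_of_pointFinite {X : Type*} [TopologicalSpace X] [T2Space X]
    {x y : ℕ → X} (hxy : ∀ k j, x k ≠ y j) {V V' : ℕ → Set X}
    (hV : ∀ k, IsOpen (V k)) (hV' : ∀ k, IsOpen (V' k))
    (hfin : ∀ p, {k | p ∈ V k}.Finite) (hfin' : ∀ p, {k | p ∈ V' k}.Finite)
    (hx : ∀ k, x k ∈ V k) (hy : ∀ k, y k ∈ V' k) :
    ∃ G G' : Set X, IsGδ G ∧ IsGδ G' ∧ Disjoint G G' ∧ (∀ k, x k ∈ G) ∧ ∀ k, y k ∈ G' := by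
  choose O O' hO hO' hxO hyO hdisj using fun k j => t2_separation (hxy k j)
  refine ⟨⋃ k, ⋂ m, V k ∩ ⋂ j ∈ Iic m, O k j, ⋃ j, ⋂ m, V' j ∩ ⋂ k ∈ Iic m, O' k j,
    ?_, ?_, ?_, ?_, ?_⟩
  · exact isGδ_iUnion_iInter_of_pointFinite hfin
      (fun k m => (hV k).inter ((finite_Iic m).isOpen_biInter fun j _ => hO k j))
      (fun k m => inter_subset_left)
      (fun k m n hmn => inter_subset_inter_right _
        (biInter_subset_biInter_left (Iic_subset_Iic.2 hmn)))
  · exact isGδ_iUnion_iInter_of_pointFinite hfin'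
      (fun j m => (hV' j).inter ((finite_Iic m).isOpen_biInter fun k _ => hO' k j))
      (fun j m => inter_subset_left)
      (fun j m n hmn => inter_subset_inter_right _
        (biInter_subset_biInter_left (Iic_subset_Iic.2 hmn)))
  -- A common point would lie in both `O k j` (stage `m = j`) and `O' k j` (stage `m = k`).
  · rw [disjoint_left]
    intro p hp hp'
    simp only [mem_iUnion, mem_iInter, mem_inter_iff, mem_Iic] at hp hp'
    obtain ⟨k, hk⟩ := hp
    obtain ⟨j, hj⟩ := hp'
    exact disjoint_left.1 (hdisj k j) ((hk j).2 j le_rfl) ((hj k).2 k le_rfl)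
  · exact fun k => mem_iUnion.2 ⟨k, mem_iInter.2 fun m => ⟨hx k, mem_iInter₂.2 fun j _ => hxO k j⟩⟩
  · exact fun j => mem_iUnion.2 ⟨j, mem_iInter.2 fun m => ⟨hy j, mem_iInter₂.2 fun k _ => hyO k j⟩⟩

namespace Cp

variable {X : Type*} [TopologicalSpace X]

theorem continuous_eval (x : X) : Continuous fun f : Cp X => f.1 x :=
  (continuous_apply x).comp continuous_subtype_val

/-- The continuous functions bounded by `r` on the set `S`. -/
def boundedOn (S : Set X) (r : ℝ) : Set (Cp X) :=
  {f | ∀ x ∈ S, |f.1 x| ≤ r}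

theorem isClosed_boundedOn (S : Set X) (r : ℝ) : IsClosed (boundedOn S r) := by
  simp only [boundedOn, ofPred_forall]
  exact isClosed_biInter fun x _ => isClosed_le (continuous_eval x).abs continuous_const

theorem interior_boundedOn [T35Space X] {S : Set X} (hS : S.Infinite) (r : ℝ) :
    interior (boundedOn S r) = ∅ := by
  rw [eq_empty_iff_forall_notMem]
  intro f hf
  obtain ⟨U, hU, hUeq⟩ := isOpen_induced_iff.1 (isOpen_interior (s := boundedOn S r))
  have hfU : f.1 ∈ U := by rwa [← hUeq] at hf
  obtain ⟨I, u, hu, hIU⟩ := isOpen_pi_iff.1 hU f.1 hfU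
  obtain ⟨x, hxS, hxI⟩ := hS.exists_notMem_finset I
  obtain ⟨h, hh, hhx, hhI⟩ :=
    CompletelyRegularSpace.completely_regular x (I : Set X) I.finite_toSet.isClosed (by simpa)
  let g : Cp X := ⟨fun y => f.1 y + (r + 1 - f.1 x) * (1 - (h y : ℝ)), by
    have := f.2
    fun_prop⟩
  have hg : g ∈ interior (boundedOn S r) := by
    rw [← hUeq]
    refine hIU fun a ha => ?_
    have hga : g.1 a = f.1 a := by simp [g, hhI ha]
    rw [hga]
    exact (hu a ha).2
  have hgx : g.1 x = r + 1 := by simp [g, hhx]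
  have := (le_abs_self _).trans (interior_subset hg x hxS)
  linarith

theorem isNowhereDense_boundedOn [T35Space X] {S : Set X} (hS : S.Infinite) (r : ℝ) :
    IsNowhereDense (boundedOn S r) :=
  (isClosed_boundedOn S r).isNowhereDense_iff.2 (interior_boundedOn hS r)

theorem exists_nat_forall_abs_le {K : Set (Cp X)} (hK : IsCompact K) (x : X) :
    ∃ n : ℕ, ∀ f ∈ K, |f.1 x| ≤ n := by
  obtain ⟨C, hC⟩ := hK.exists_bound_of_continuousOn (continuous_eval x).continuousOn
  obtain ⟨n, hn⟩ := exists_nat_ge C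
  exact ⟨n, fun f hf => (hC f hf).trans hn⟩

/-- If a compact set of continuous functions is unbounded on each `S i`, then there are disjoint
`Gδ`-sets meeting all of the sets `S i`. -/
theorem exists_disjoint_isGδ_of_not_subset_boundedOn [T2Space X] {S : ℕ → Set X}
    {K : Set (Cp X)} (hK : IsCompact K) (hS : ∀ i n : ℕ, ¬ K ⊆ boundedOn (S i) n) :
    ∃ G G' : Set X, IsGδ G ∧ IsGδ G' ∧ Disjoint G G' ∧
      (∀ i, (G ∩ S i).Nonempty) ∧ ∀ i, (G' ∩ S i).Nonempty := by
  choose b hb using exists_nat_forall_abs_le hK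
  have hex : ∀ i n : ℕ, ∃ f ∈ K, ∃ x ∈ S i, (n : ℝ) < |f.1 x| := by
    intro i n
    simpa [boundedOn, not_subset] using hS i n
  choose f hfK x hxS hfx using hex
  -- Halving `i` makes each set occur twice; the `b` term makes `b` strictly increasing along the
  -- chosen points, which are therefore distinct.
  obtain ⟨N, hNsucc⟩ : ∃ N : ℕ → ℕ, ∀ i, N (i + 1) = max (N i + 1) (b (x (i / 2) (N i))) :=
    ⟨fun i => Nat.rec 0 (fun i n => max (n + 1) (b (x (i / 2) n))) i, fun _ => rfl⟩
  have hN : StrictMono N := strictMono_nat_of_lt_succ fun i => by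
    rw [hNsucc]
    exact (Nat.lt_succ_self _).trans_le (le_max_left _ _)
  let z : ℕ → X := fun i => x (i / 2) (N i)
  let V : ℕ → Set X := fun i => {y | (N i : ℝ) < |(f (i / 2) (N i)).1 y|}
  have hVopen : ∀ i, IsOpen (V i) := fun i =>
    isOpen_lt continuous_const (f (i / 2) (N i)).2.abs
  have hzV : ∀ i, z i ∈ V i := fun i => hfx _ _
  have hNb : ∀ {i y}, y ∈ V i → N i < b y := fun {i y} hy =>
    Nat.cast_lt.1 (lt_of_lt_of_le hy (hb y _ (hfK _ _)))
  have hz : Function.Injective z := by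
    refine Function.Injective.of_comp (f := b) (StrictMono.injective ?_)
    refine strictMono_nat_of_lt_succ fun i => ?_
    calc b (z i) ≤ N (i + 1) := by
          rw [hNsucc]
          exact le_max_right _ _
      _ < b (z (i + 1)) := hNb (hzV _)
  have hfin : ∀ y, {i | y ∈ V i}.Finite := fun y =>
    (finite_Iio (b y)).subset fun i hi => (hN.id_le i).trans_lt (hNb hi)
  obtain ⟨G, G', hG, hG', hdisj, hzG, hzG'⟩ :=
    exists_disjoint_isGδ_of_pointFinite (x := fun k => z (2 * k)) (y := fun k => z (2 * k + 1))
      (fun k j h => by have := hz h; omega)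
      (fun k => hVopen (2 * k)) (fun k => hVopen (2 * k + 1))
      (fun p => (hfin p).preimage (f := fun k => 2 * k) fun i _ j _ h => by
        simp only at h; omega)
      (fun p => (hfin p).preimage (f := fun k => 2 * k + 1) fun i _ j _ h => by
        simp only at h; omega)
      (fun k => hzV _) (fun k => hzV _)
  refine ⟨G, G', hG, hG', hdisj, fun i => ⟨_, hzG i, ?_⟩, fun i => ⟨_, hzG' i, ?_⟩⟩
  · have : 2 * i / 2 = i := by omega
    simpa only [z, this] using hxS i (N (2 * i))
  · have : (2 * i + 1) / 2 = i := by omega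
    simpa only [z, this] using hxS i (N (2 * i + 1))

end Cp

theorem mainTheorem6 {X : Type*} [TopologicalSpace X] [T35Space X] (hX : IsAiry X) :
    BanakhProperty (Cp X) := by
  obtain ⟨P, hP, hinf, hmeet⟩ := hX
  have hPne : P.Nonempty := by
    rw [nonempty_iff_ne_empty]
    rintro rfl
    -- For empty `P`, even `∅` is `P`-dense.
    simpa using hmeet ∅ ∅ .empty .empty (by simp [FamilyDense]) (by simp [FamilyDense])
  obtain ⟨S, rfl⟩ := hP.exists_eq_range hPne
  refine ⟨fun m => Cp.boundedOn (S m.unpair.1) m.unpair.2, fun m =>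
    ⟨Cp.isClosed_boundedOn _ _, Cp.isNowhereDense_boundedOn (hinf _ (mem_range_self _)) _⟩, ?_⟩
  intro K hK
  by_contra! h
  obtain ⟨G, G', hG, hG', hdisj, hGS, hGS'⟩ :=
    Cp.exists_disjoint_isGδ_of_not_subset_boundedOn (S := S) hK fun i n => by
      simpa using h (Nat.pair i n)
  exact (hmeet G G' hG hG' (forall_mem_range.2 hGS) (forall_mem_range.2 hGS')).ne_empty
    hdisj.inter_eq
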